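/- For $N\in\mathbb N$, a frequency vector $\omega=(\omega_1,\dots,\omega_N)\in\mathbb R^N$ and a coupling constant $\gamma\in\mathbb R$, consider the Kuramoto system $$\frac{d\theta_i}{dt}=F_i(\theta):=\omega_i+\gamma\sum_{j=1}^N\sin(\theta_j-\theta_i),\qquad i=1,\dots,N .$$ Say that the system exhibits full synchrony if there is a configuration $\theta\in\mathbb R^N$ at which all oscillators are locked, i.e. $F_1(\theta)=\dots=F_N(\theta)$ (so that $\theta$ is stationary in a uniformly rotating frame), and which is stable, i.e. the Jacobian matrix $\left(\partial F_i/\partial\theta_j(\theta)\right)_{i,j}$ is negative semi-definite with a one-dimensional kernel. Let $\mathcal P_{\mathsf{sync}}(\gamma,N)$ be the probability that the system exhibits full synchrony when $\omega_1,\dots,\omega_N$ are independent Gaussian random variables with mean $0$ and variance $1$, and put $$\varphi(N)=\frac{\sqrt{2\ln N}}{N+1}.$$ Then, for every $\delta\in\mathbb R$: - if $\delta<1$, then $\lim_{N\to\infty}\mathcal P_{\mathsf{sync}}(\delta\varphi(N),N)=0$; - if $\delta\ge 2$, then $\lim_{N\to\infty}\mathcal P_{\mathsf{sync}}(\delta\varphi(N),N)=1$.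 -/

import Mathlib

open Filter Topology MeasureTheory ProbabilityTheory
open scoped ENNReal

noncomputable section

namespace Kuramoto

/-- The right-hand side of the Kuramoto system
`dθᵢ/dt = ωᵢ + γ ∑ⱼ sin (θⱼ - θᵢ)` (all-to-all coupling, the coupling constant is not divided
by `N`), with the phases lifted from the torus to `ℝ^N`. -/
def field {N : ℕ} (ω : Fin N → ℝ) (γ : ℝ) (θ : Fin N → ℝ) : Fin N → ℝ :=
  fun i => ω i + γ * ∑ j, Real.sin (θ j - θ i)

/-- The Jacobian matrix of the Kuramoto vector field at the configuration `θ`. -/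
def jacobian {N : ℕ} (ω : Fin N → ℝ) (γ : ℝ) (θ : Fin N → ℝ) : Matrix (Fin N) (Fin N) ℝ :=
  LinearMap.toMatrix' (fderiv ℝ (field ω γ) θ).toLinearMap

/-- Stability: the Jacobian is (symmetric) negative semi-definite, with one-dimensional kernel. -/
def IsStable {N : ℕ} (ω : Fin N → ℝ) (γ : ℝ) (θ : Fin N → ℝ) : Prop :=
  (-jacobian ω γ θ).PosSemidef ∧
    Module.finrank ℝ (LinearMap.ker (jacobian ω γ θ).mulVecLin) = 1

/-- `θ` is a phase-locked configuration: all oscillators rotate with one common angular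
frequency `Ω`, that is, `t ↦ θ + Ω t (1, …, 1)` solves the system. Equivalently `θ` is stationary
in the frame rotating with angular velocity `Ω` (necessarily the mean of the `ωᵢ`). -/
def IsLocked {N : ℕ} (ω : Fin N → ℝ) (γ : ℝ) (θ : Fin N → ℝ) : Prop :=
  ∃ Ω : ℝ, ∀ i, field ω γ θ i = Ω

/-- Full synchrony for the frequency vector `ω` at coupling `γ`: there is a stable configuration
in which all oscillators are locked. -/
def FullSynchrony {N : ℕ} (ω : Fin N → ℝ) (γ : ℝ) : Prop :=
  ∃ θ : Fin N → ℝ, IsLocked ω γ θ ∧ IsStable ω γ θ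

/-- The probability of full synchrony of `N` oscillators at coupling `γ`, when the frequencies
are independent standard Gaussian random variables. -/
def probSync (γ : ℝ) (N : ℕ) : ℝ≥0∞ :=
  (Measure.pi fun _ : Fin N => gaussianReal 0 1) {ω | FullSynchrony ω γ}

/-- The scaling `φ(N) = √(2 ln N) / (N + 1)`. -/
def scaling (N : ℕ) : ℝ := Real.sqrt (2 * Real.log N) / (N + 1)

end Kuramoto

end

/-!
Write `L = √(2 log N)`, the order of magnitude of the maximum of `N` independent standard Gaussian
variables; at coupling `γ = δ φ(N)` one has `γ N = δ L N / (N + 1)`.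

*Below the threshold.* In a locked state each `ωᵢ` differs from the common frequency by
`|γ ∑ⱼ sin (θⱼ - θᵢ)|`. For `γ ≥ 0` this is at most `γ N`. For `γ < 0` the diagonal of the negative
semidefinite Jacobian gives `∑ⱼ cos (θⱼ - θᵢ) ≤ 1` for all `i`, hence `|∑ⱼ exp (i θⱼ)| ^ 2 ≤ N`, and
the difference is at most `|γ| √N` (`FullSynchrony.exists_abs_sub_le`). So for `δ < 1` and large `N`
all frequencies lie in an interval of radius `c L` with `c < 1`, and, according to the sign of its
centre, all are at most `c L` or all are at least `-c L`. Either event has probability at most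
`exp (-N q)`, where `q`, the Gaussian density at `c L + 1`, bounds the tail beyond `c L` from below,
and `N q → ∞`.

*Above the threshold.* If all `uᵢ = (ωᵢ - mean) / γ` satisfy `|uᵢ| < N / 2`, the intermediate value
theorem solves the self-consistency equation `∑ᵢ √(r ^ 2 - uᵢ ^ 2) = r ^ 2` with `r ≥ N / √2`. Then
`θᵢ = arcsin (uᵢ / r)` is locked with order parameter `r` and satisfies `|θᵢ| < π / 4`, so that the
Jacobian is `-γ` times a Laplacian with positive weights `cos (θⱼ - θᵢ)`, and `θ` is stable
(`fullSynchrony_of_abs_sub_lt`). For `δ ≥ 2` the hypothesis holds as soon as all `|ωᵢ| < L - 1 / L`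
and the mean is below `1 / (2 L)` in modulus. The first fails with probability `O(1 / L)` by the
union bound and Mills' bound, whose factor `1 / L` is decisive at this borderline scale; the second
fails with probability at most `4 L ^ 2 / N` by Chebyshev's inequality.
-/

namespace Kuramoto

/-! ### The Jacobian as a weighted Laplacian -/

section Jacobian

variable {N : ℕ} (ω : Fin N → ℝ) (γ : ℝ) (θ : Fin N → ℝ)

lemma jacobian_mulVec (v : Fin N → ℝ) :
    (jacobian ω γ θ).mulVec v = fun i => γ * ∑ j, Real.cos (θ j - θ i) * (v j - v i) := by
  have h : HasFDerivAt (field ω γ)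
      (ContinuousLinearMap.pi fun i => γ • ∑ j, Real.cos (θ j - θ i) •
        (ContinuousLinearMap.proj (R := ℝ) (φ := fun _ : Fin N => ℝ) j -
          ContinuousLinearMap.proj i)) θ := by
    rw [hasFDerivAt_pi]
    intro i
    refine HasFDerivAt.const_add _ (HasFDerivAt.const_mul ?_ γ)
    refine HasFDerivAt.fun_sum fun j _ => ?_
    exact ((hasFDerivAt_apply j θ).sub (hasFDerivAt_apply i θ)).sin
  rw [jacobian, h.fderiv, ← Matrix.toLin'_apply, Matrix.toLin'_toMatrix']
  ext i
  simp

lemma jacobian_apply (i k : Fin N) :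
    jacobian ω γ θ i k =
      γ * (Real.cos (θ k - θ i) - if i = k then ∑ j, Real.cos (θ j - θ i) else 0) := by
  have h := congrFun (jacobian_mulVec ω γ θ (Pi.single k 1)) i
  rw [Matrix.mulVec_single_one, Matrix.col_apply] at h
  rw [h]
  congr 1
  simp only [mul_sub, Finset.sum_sub_distrib, ← Finset.sum_mul, Pi.single_apply]
  simp

lemma isHermitian_jacobian : (jacobian ω γ θ).IsHermitian := by
  ext i k
  rw [Matrix.conjTranspose_apply, star_trivial, jacobian_apply, jacobian_apply,
    ← Real.cos_neg (θ k - θ i), neg_sub]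
  rcases eq_or_ne i k with rfl | h
  · rfl
  · rw [if_neg h, if_neg h.symm]

/-- The Jacobian is `-γ` times the Laplacian of the complete graph with edge weights
`cos (θⱼ - θᵢ)`. -/
lemma dotProduct_neg_jacobian_mulVec (v : Fin N → ℝ) :
    v ⬝ᵥ (-jacobian ω γ θ).mulVec v =
      γ / 2 * ∑ i, ∑ j, Real.cos (θ j - θ i) * (v j - v i) ^ 2 := by
  have hswap : ∑ i, ∑ j, Real.cos (θ j - θ i) * (v j - v i) * v j =
      -∑ i, ∑ j, Real.cos (θ j - θ i) * (v j - v i) * v i := by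
    rw [Finset.sum_comm, ← Finset.sum_neg_distrib]
    refine Finset.sum_congr rfl fun i _ => ?_
    rw [← Finset.sum_neg_distrib]
    refine Finset.sum_congr rfl fun j _ => ?_
    rw [← Real.cos_neg (θ j - θ i), neg_sub]
    ring
  have hsq : ∑ i, ∑ j, Real.cos (θ j - θ i) * (v j - v i) ^ 2 =
      -2 * ∑ i, ∑ j, Real.cos (θ j - θ i) * (v j - v i) * v i := by
    calc _ = ∑ i, ∑ j, Real.cos (θ j - θ i) * (v j - v i) * v j -
        ∑ i, ∑ j, Real.cos (θ j - θ i) * (v j - v i) * v i := by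
          simp only [← Finset.sum_sub_distrib]
          exact Finset.sum_congr rfl fun i _ => Finset.sum_congr rfl fun j _ => by ring
      _ = _ := by rw [hswap]; ring
  rw [hsq, Matrix.neg_mulVec, jacobian_mulVec, dotProduct]
  simp only [Pi.neg_apply, Finset.mul_sum, ← Finset.sum_neg_distrib]
  exact Finset.sum_congr rfl fun i _ => Finset.sum_congr rfl fun j _ => by ring

variable {γ θ} in
/-- If all pairwise phase differences have positive cosine, the weights of the Laplacian are
positive and its kernel consists of the constant vectors. -/
lemma isStable_of_cos_pos (hN : 0 < N) (hγ : 0 < γ)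
    (hcos : ∀ i j, 0 < Real.cos (θ j - θ i)) : IsStable ω γ θ := by
  constructor
  · refine Matrix.PosSemidef.of_dotProduct_mulVec_nonneg (isHermitian_jacobian ω γ θ).neg
      fun v => ?_
    rw [star_trivial, dotProduct_neg_jacobian_mulVec]
    exact mul_nonneg (by positivity) (Finset.sum_nonneg fun i _ => Finset.sum_nonneg fun j _ =>
      mul_nonneg (hcos i j).le (sq_nonneg _))
  · refine finrank_eq_one_iff'.2 ⟨⟨fun _ => 1, ?_⟩, ?_, ?_⟩
    · rw [LinearMap.mem_ker, Matrix.mulVecLin_apply, jacobian_mulVec]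
      ext i
      simp
    · intro h
      simpa using congrFun (congrArg Subtype.val h) ⟨0, hN⟩
    · rintro ⟨v, hv⟩
      rw [LinearMap.mem_ker, Matrix.mulVecLin_apply] at hv
      have h0 := dotProduct_neg_jacobian_mulVec ω γ θ v
      rw [Matrix.neg_mulVec, hv, neg_zero, dotProduct_zero, eq_comm, mul_eq_zero,
        or_iff_right (by positivity), Finset.sum_eq_zero_iff_of_nonneg fun i _ =>
          Finset.sum_nonneg fun j _ => mul_nonneg (hcos i j).le (sq_nonneg _)] at h0
      have h1 := (Finset.sum_eq_zero_iff_of_nonneg fun j _ =>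
        mul_nonneg (hcos ⟨0, hN⟩ j).le (sq_nonneg _)).1 (h0 ⟨0, hN⟩ (Finset.mem_univ _))
      refine ⟨v ⟨0, hN⟩, Subtype.ext (funext fun j => ?_)⟩
      have h2 := h1 j (Finset.mem_univ _)
      rw [mul_eq_zero, or_iff_right (hcos _ _).ne', sq_eq_zero_iff, sub_eq_zero] at h2
      simp [h2]

end Jacobian

/-! ### A necessary condition for full synchrony -/

/-- For repulsive coupling the nonnegative diagonal of the negated Jacobian bounds the order
parameter: `|∑ⱼ exp (i θⱼ)| ^ 2 ≤ N`. -/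
lemma sq_sum_cos_add_sq_sum_sin_le {N : ℕ} {ω θ : Fin N → ℝ} {γ : ℝ} (hγ : γ < 0)
    (h : IsStable ω γ θ) :
    (∑ j, Real.cos (θ j)) ^ 2 + (∑ j, Real.sin (θ j)) ^ 2 ≤ N := by
  have hd (i : Fin N) : ∑ j, Real.cos (θ j - θ i) ≤ 1 := by
    have := h.1.diag_nonneg (i := i)
    rw [Matrix.neg_apply, jacobian_apply, if_pos rfl, sub_self, Real.cos_zero] at this
    nlinarith
  calc _ = ∑ i, ∑ j, Real.cos (θ j - θ i) := by
        simp only [Real.cos_sub, Finset.sum_add_distrib, ← Finset.sum_mul, ← Finset.mul_sum]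
        ring
    _ ≤ ∑ _i : Fin N, (1 : ℝ) := Finset.sum_le_sum fun i _ => hd i
    _ = N := by simp

/-- In a stable locked state every frequency is close to the common one. The coupling term is
trivially at most `N γ`; for `γ < 0` stability improves this to `√N |γ|`. -/
lemma FullSynchrony.exists_abs_sub_le {N : ℕ} {ω : Fin N → ℝ} {γ : ℝ} (h : FullSynchrony ω γ) :
    ∃ Ω : ℝ, ∀ i, |ω i - Ω| ≤ if 0 ≤ γ then γ * N else -γ * Real.sqrt N := by
  obtain ⟨θ, ⟨Ω, hΩ⟩, hst⟩ := h
  refine ⟨Ω, fun i => ?_⟩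
  have hi : ω i - Ω = -(γ * ∑ j, Real.sin (θ j - θ i)) := by
    rw [← hΩ i, field]; ring
  rw [hi, abs_neg, abs_mul]
  split_ifs with hγ
  · rw [abs_of_nonneg hγ]
    refine mul_le_mul_of_nonneg_left ?_ hγ
    calc _ ≤ ∑ j, |Real.sin (θ j - θ i)| := Finset.abs_sum_le_sum_abs _ _
      _ ≤ ∑ _j : Fin N, (1 : ℝ) := Finset.sum_le_sum fun j _ => Real.abs_sin_le_one _
      _ = N := by simp
  · push Not at hγ
    rw [abs_of_neg hγ]
    refine mul_le_mul_of_nonneg_left ?_ (by linarith)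
    refine Real.abs_le_sqrt ((le_trans ?_ (sq_sum_cos_add_sq_sum_sin_le hγ hst)))
    have : ∑ j, Real.sin (θ j - θ i) =
        (∑ j, Real.sin (θ j)) * Real.cos (θ i) - (∑ j, Real.cos (θ j)) * Real.sin (θ i) := by
      simp only [Real.sin_sub, Finset.sum_sub_distrib, Finset.sum_mul]
    rw [this]
    -- Cauchy–Schwarz against the unit vector `(cos θᵢ, sin θᵢ)`
    nlinarith [sq_nonneg ((∑ j, Real.sin (θ j)) * Real.sin (θ i) +
      (∑ j, Real.cos (θ j)) * Real.cos (θ i)), Real.sin_sq_add_cos_sq (θ i)]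

/-! ### A sufficient condition for full synchrony -/

/-- The self-consistency equation for the order parameter `r`. At `r = N / √2` each summand is at
least `N / 2`, at `r = N` each is at most `N`. -/
lemma exists_sum_sqrt_eq_sq {N : ℕ} {u : Fin N → ℝ} (hu : ∀ i, |u i| < N / 2) :
    ∃ r : ℝ, N / Real.sqrt 2 ≤ r ∧ ∑ i, Real.sqrt (r ^ 2 - u i ^ 2) = r ^ 2 := by
  have h2 : (1 : ℝ) ≤ Real.sqrt 2 := Real.one_le_sqrt.2 (by norm_num)
  have hle : (N : ℝ) / Real.sqrt 2 ≤ N := div_le_self (Nat.cast_nonneg N) h2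
  have hcont : ContinuousOn (fun r : ℝ => ∑ i, Real.sqrt (r ^ 2 - u i ^ 2) - r ^ 2)
      (Set.Icc ((N : ℝ) / Real.sqrt 2) N) := by
    apply Continuous.continuousOn
    fun_prop
  have hmem : (0 : ℝ) ∈ Set.Icc (∑ i, Real.sqrt ((N : ℝ) ^ 2 - u i ^ 2) - (N : ℝ) ^ 2)
      (∑ i, Real.sqrt (((N : ℝ) / Real.sqrt 2) ^ 2 - u i ^ 2) - ((N : ℝ) / Real.sqrt 2) ^ 2) := by
    constructor
    · have : ∑ i, Real.sqrt ((N : ℝ) ^ 2 - u i ^ 2) ≤ ∑ _i : Fin N, (N : ℝ) :=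
        Finset.sum_le_sum fun i _ =>
          Real.sqrt_le_iff.2 ⟨Nat.cast_nonneg N, by nlinarith [sq_nonneg (u i)]⟩
      simp only [Finset.sum_const, Finset.card_univ, Fintype.card_fin, nsmul_eq_mul] at this
      nlinarith
    · rw [div_pow, Real.sq_sqrt (by norm_num)]
      have : ∑ _i : Fin N, (N : ℝ) / 2 ≤ ∑ i, Real.sqrt ((N : ℝ) ^ 2 / 2 - u i ^ 2) :=
        Finset.sum_le_sum fun i _ => Real.le_sqrt_of_sq_le (by
          have := sq_lt_sq' (abs_lt.1 (hu i)).1 (abs_lt.1 (hu i)).2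
          nlinarith)
      simp only [Finset.sum_const, Finset.card_univ, Fintype.card_fin, nsmul_eq_mul] at this
      nlinarith
  obtain ⟨r, hr, hr0⟩ := intermediate_value_Icc' hle hcont hmem
  exact ⟨r, hr.1, sub_eq_zero.1 hr0⟩

/-- If the frequencies stay within `γ N / 2` of their mean, there is a locked state
`θᵢ = arcsin (uᵢ / r)`, `uᵢ = (ωᵢ - Ω) / γ`, inside an arc of length less than `π / 2`. -/
lemma fullSynchrony_of_abs_sub_lt {N : ℕ} {ω : Fin N → ℝ} {γ Ω : ℝ} (hN : 0 < N) (hγ : 0 < γ)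
    (hΩ : ∑ i, ω i = N * Ω) (h : ∀ i, |ω i - Ω| < γ * N / 2) : FullSynchrony ω γ := by
  set u : Fin N → ℝ := fun i => (ω i - Ω) / γ with hu_def
  have hu (i : Fin N) : |u i| < N / 2 := by
    rw [hu_def, abs_div, abs_of_pos hγ, div_lt_iff₀ hγ]
    linarith [h i]
  have hsum : ∑ i, u i = 0 := by
    simp [hu_def, ← Finset.sum_div, hΩ]
  obtain ⟨r, hr, hrsum⟩ := exists_sum_sqrt_eq_sq hu
  have hN' : (0 : ℝ) < N := Nat.cast_pos.2 hN
  have hs2 : 0 < Real.sqrt 2 := by positivity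
  have hr0 : 0 < r := lt_of_lt_of_le (by positivity) hr
  have hs : Real.sqrt 2 * Real.sqrt 2 = 2 := Real.mul_self_sqrt (by norm_num)
  have hur (i : Fin N) : |u i / r| < Real.sqrt 2 / 2 := by
    rw [abs_div, abs_of_pos hr0, div_lt_iff₀ hr0]
    rw [div_le_iff₀ hs2] at hr
    linarith [hu i]
  have hs1 : Real.sqrt 2 / 2 ≤ 1 := by nlinarith
  have hu1 (i : Fin N) : -1 ≤ u i / r ∧ u i / r ≤ 1 :=
    ⟨by linarith [(abs_lt.1 (hur i)).1], by linarith [(abs_lt.1 (hur i)).2]⟩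
  set θ : Fin N → ℝ := fun i => Real.arcsin (u i / r) with hθ_def
  have hsin (i : Fin N) : Real.sin (θ i) = u i / r := Real.sin_arcsin (hu1 i).1 (hu1 i).2
  have hcos (i : Fin N) : Real.cos (θ i) = Real.sqrt (r ^ 2 - u i ^ 2) / r := by
    rw [hθ_def, Real.cos_arcsin, ← Real.sqrt_sq hr0.le, ← Real.sqrt_div' _ (sq_nonneg r),
      Real.sqrt_sq hr0.le]
    congr 1
    field_simp
  have hθ (i : Fin N) : |θ i| < Real.pi / 4 := by
    have hpi := Real.pi_pos
    rw [abs_lt]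
    constructor
    · refine (Real.lt_arcsin_iff_sin_lt' ⟨by linarith, by linarith⟩).2 ?_
      rw [Real.sin_neg, Real.sin_pi_div_four]
      exact (abs_lt.1 (hur i)).1
    · refine (Real.arcsin_lt_iff_lt_sin' ⟨by linarith, by linarith⟩).2 ?_
      rw [Real.sin_pi_div_four]
      exact (abs_lt.1 (hur i)).2
  refine ⟨θ, ⟨Ω, fun i => ?_⟩, isStable_of_cos_pos ω hN hγ fun i j => ?_⟩
  · have hsc : ∑ j, Real.cos (θ j) = r := by
      simp only [hcos, ← Finset.sum_div, hrsum]
      field_simp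
    have hss : ∑ j, Real.sin (θ j) = 0 := by
      simp only [hsin, ← Finset.sum_div, hsum, zero_div]
    simp only [field, Real.sin_sub, Finset.sum_sub_distrib, ← Finset.sum_mul, hsc, hss, hsin i,
      hu_def]
    field_simp
    ring
  · have h1 := abs_lt.1 (hθ i)
    have h2 := abs_lt.1 (hθ j)
    exact Real.cos_pos_of_mem_Ioo ⟨by linarith, by linarith⟩

/-! ### Gaussian tails and maxima of independent Gaussian variables -/

lemma gaussianPDFReal_zero_one (x : ℝ) :
    gaussianPDFReal 0 1 x = (Real.sqrt (2 * Real.pi))⁻¹ * Real.exp (-x ^ 2 / 2) := by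
  simp [gaussianPDFReal]

lemma gaussianReal_Iic_neg (t : ℝ) :
    gaussianReal 0 1 (Set.Iic (-t)) = gaussianReal 0 1 (Set.Ici t) := by
  have h := gaussianReal_map_neg (μ := 0) (v := 1)
  rw [neg_zero] at h
  conv_rhs => rw [← h, Measure.map_apply measurable_neg measurableSet_Ici]
  congr 1
  ext x
  simp only [Set.mem_Iic, Set.mem_preimage, Set.mem_Ici]
  exact le_neg

lemma le_gaussianReal_Ioi {a : ℝ} (ha : 0 ≤ a) :
    ENNReal.ofReal (gaussianPDFReal 0 1 (a + 1)) ≤ gaussianReal 0 1 (Set.Ioi a) := by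
  calc ENNReal.ofReal (gaussianPDFReal 0 1 (a + 1))
      = ∫⁻ _x in Set.Ioc a (a + 1), ENNReal.ofReal (gaussianPDFReal 0 1 (a + 1)) := by
        simp
    _ ≤ ∫⁻ x in Set.Ioc a (a + 1), gaussianPDF 0 1 x := by
        refine setLIntegral_mono (measurable_gaussianPDF 0 1) fun x hx => ?_
        refine ENNReal.ofReal_le_ofReal ?_
        rw [gaussianPDFReal_zero_one, gaussianPDFReal_zero_one]
        refine mul_le_mul_of_nonneg_left (Real.exp_le_exp.2 ?_) (by positivity)
        nlinarith [hx.1, hx.2]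
    _ ≤ ∫⁻ x in Set.Ioi a, gaussianPDF 0 1 x := lintegral_mono_set Set.Ioc_subset_Ioi_self
    _ = _ := (gaussianReal_apply 0 one_ne_zero _).symm

/-- Mills' bound, without the factor `1 / √(2π)`. -/
lemma gaussianReal_Ici_le {t : ℝ} (ht : 0 < t) :
    gaussianReal 0 1 (Set.Ici t) ≤ ENNReal.ofReal (Real.exp (-t ^ 2 / 2) / t) := by
  have hderiv (x : ℝ) : HasDerivAt (fun y : ℝ => -Real.exp (-y ^ 2 / 2) / t)
      (x * Real.exp (-x ^ 2 / 2) / t) x := by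
    have h := ((((hasDerivAt_pow 2 x).neg.div_const 2).exp).neg).div_const t
    exact h.congr_deriv (by norm_num; ring)
  have hlim : Tendsto (fun y : ℝ => -Real.exp (-y ^ 2 / 2) / t) atTop (𝓝 0) := by
    have h1 : Tendsto (fun y : ℝ => -y ^ 2 / 2) atTop atBot := by
      have := (tendsto_pow_atTop (α := ℝ) two_ne_zero).atTop_div_const (zero_lt_two)
      exact (tendsto_neg_atTop_atBot.comp this).congr fun y => (neg_div 2 (y ^ 2)).symm
    simpa using ((Real.tendsto_exp_atBot.comp h1).neg).div_const t
  have hpos : ∀ x ∈ Set.Ioi t, 0 ≤ x * Real.exp (-x ^ 2 / 2) / t := fun x hx =>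
    div_nonneg (mul_nonneg (ht.le.trans (le_of_lt hx)) (Real.exp_pos _).le) ht.le
  have hint := integrableOn_Ioi_deriv_of_nonneg'
    (fun x _ => hderiv x) hpos hlim
  have hval := integral_Ioi_of_hasDerivAt_of_nonneg' (fun x _ => hderiv x) hpos hlim
  rw [gaussianReal_apply 0 one_ne_zero, setLIntegral_congr Ioi_ae_eq_Ici.symm]
  calc ∫⁻ x in Set.Ioi t, gaussianPDF 0 1 x
      ≤ ∫⁻ x in Set.Ioi t, ENNReal.ofReal (x * Real.exp (-x ^ 2 / 2) / t) := by
        refine setLIntegral_mono (by fun_prop) fun x hx => ENNReal.ofReal_le_ofReal ?_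
        rw [gaussianPDFReal_zero_one]
        have h1 : (Real.sqrt (2 * Real.pi))⁻¹ ≤ 1 :=
          inv_le_one_of_one_le₀ (Real.one_le_sqrt.2 (by linarith [Real.pi_gt_three]))
        have h2 : 1 ≤ x / t := (one_le_div ht).2 (le_of_lt hx)
        calc _ ≤ x / t * Real.exp (-x ^ 2 / 2) :=
              mul_le_mul_of_nonneg_right (h1.trans h2) (Real.exp_pos _).le
          _ = _ := by ring
    _ = ENNReal.ofReal (∫ x in Set.Ioi t, x * Real.exp (-x ^ 2 / 2) / t) :=
        (ofReal_integral_eq_lintegral_ofReal hint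
          ((ae_restrict_iff' measurableSet_Ioi).2 (ae_of_all _ hpos))).symm
    _ = _ := by rw [hval]; congr 1; ring

/-- The law of `N` independent standard Gaussian variables. -/
noncomputable abbrev stdGaussianPi (N : ℕ) : Measure (Fin N → ℝ) :=
  Measure.pi fun _ => gaussianReal 0 1

lemma gaussianReal_Iic_pow_le {a : ℝ} (ha : 0 ≤ a) (N : ℕ) :
    gaussianReal 0 1 (Set.Iic a) ^ N ≤
      ENNReal.ofReal (Real.exp (-(N * gaussianPDFReal 0 1 (a + 1)))) := by
  have h1 : gaussianReal 0 1 (Set.Iic a) ≤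
      ENNReal.ofReal (Real.exp (-gaussianPDFReal 0 1 (a + 1))) := by
    rw [← Set.compl_Ioi, prob_compl_eq_one_sub measurableSet_Ioi]
    calc _ ≤ 1 - ENNReal.ofReal (gaussianPDFReal 0 1 (a + 1)) :=
          tsub_le_tsub_left (le_gaussianReal_Ioi ha) 1
      _ = ENNReal.ofReal (1 - gaussianPDFReal 0 1 (a + 1)) := by
          rw [ENNReal.ofReal_sub _ (gaussianPDFReal_nonneg 0 1 _), ENNReal.ofReal_one]
      _ ≤ _ := ENNReal.ofReal_le_ofReal (Real.one_sub_le_exp_neg _)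
  calc _ ≤ ENNReal.ofReal (Real.exp (-gaussianPDFReal 0 1 (a + 1))) ^ N := by gcongr
    _ = _ := by
      rw [← ENNReal.ofReal_pow (Real.exp_pos _).le, ← Real.exp_nat_mul, mul_neg]

lemma stdGaussianPi_forall_le {a : ℝ} (ha : 0 ≤ a) (N : ℕ) :
    stdGaussianPi N {ω | ∀ i, ω i ≤ a} ≤
      ENNReal.ofReal (Real.exp (-(N * gaussianPDFReal 0 1 (a + 1)))) := by
  have : {ω : Fin N → ℝ | ∀ i, ω i ≤ a} = Set.univ.pi fun _ => Set.Iic a := by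
    ext; simp [Pi.le_def]
  rw [this, Measure.pi_pi, Finset.prod_const, Finset.card_univ, Fintype.card_fin]
  exact gaussianReal_Iic_pow_le ha N

lemma stdGaussianPi_forall_neg_le {a : ℝ} (ha : 0 ≤ a) (N : ℕ) :
    stdGaussianPi N {ω | ∀ i, -a ≤ ω i} ≤
      ENNReal.ofReal (Real.exp (-(N * gaussianPDFReal 0 1 (a + 1)))) := by
  have : {ω : Fin N → ℝ | ∀ i, -a ≤ ω i} = Set.univ.pi fun _ => Set.Ici (-a) := by
    ext; simp [Pi.le_def]
  rw [this, Measure.pi_pi, Finset.prod_const, Finset.card_univ, Fintype.card_fin,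
    ← gaussianReal_Iic_neg, neg_neg]
  exact gaussianReal_Iic_pow_le ha N

lemma stdGaussianPi_exists_le_abs {t : ℝ} (ht : 0 < t) (N : ℕ) :
    stdGaussianPi N {ω | ∃ i, t ≤ |ω i|} ≤
      ENNReal.ofReal (N * (2 * (Real.exp (-t ^ 2 / 2) / t))) := by
  have hone (i : Fin N) : stdGaussianPi N {ω | t ≤ |ω i|} ≤
      ENNReal.ofReal (2 * (Real.exp (-t ^ 2 / 2) / t)) := by
    have hset : {ω : Fin N → ℝ | t ≤ |ω i|} =
        Function.eval i ⁻¹' (Set.Iic (-t) ∪ Set.Ici t) := by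
      ext ω
      simp only [Set.mem_ofPred_eq, Set.mem_preimage, Set.mem_union, Set.mem_Iic, Set.mem_Ici,
        Function.eval, le_abs', or_comm]
    rw [hset, (measurePreserving_eval _ i).measure_preimage
      (measurableSet_Iic.union measurableSet_Ici).nullMeasurableSet]
    calc _ ≤ gaussianReal 0 1 (Set.Iic (-t)) + gaussianReal 0 1 (Set.Ici t) :=
          measure_union_le _ _
      _ ≤ _ := by
          rw [gaussianReal_Iic_neg, two_mul, ENNReal.ofReal_add (by positivity) (by positivity)]
          exact add_le_add (gaussianReal_Ici_le ht) (gaussianReal_Ici_le ht)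
  rw [Set.ofPred_exists]
  calc _ ≤ ∑ i : Fin N, stdGaussianPi N {ω | t ≤ |ω i|} := measure_iUnion_fintype_le _ _
    _ ≤ ∑ _i : Fin N, ENNReal.ofReal (2 * (Real.exp (-t ^ 2 / 2) / t)) :=
        Finset.sum_le_sum fun i _ => hone i
    _ = _ := by
        rw [Finset.sum_const, Finset.card_univ, Fintype.card_fin, nsmul_eq_mul,
          ENNReal.ofReal_mul (Nat.cast_nonneg N), ENNReal.ofReal_natCast]

lemma stdGaussianPi_le_abs_sum {c : ℝ} (hc : 0 < c) (N : ℕ) :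
    stdGaussianPi N {ω | c ≤ |∑ i, ω i|} ≤ ENNReal.ofReal (N / c ^ 2) := by
  have hmem (i : Fin N) : MemLp (fun ω : Fin N → ℝ => ω i) 2 (stdGaussianPi N) :=
    (memLp_id_gaussianReal 2).comp_measurePreserving
      (measurePreserving_eval (fun _ : Fin N => gaussianReal 0 1) i)
  have hmean (i : Fin N) : ∫ ω, ω i ∂(stdGaussianPi N) = 0 := by
    have h := (measurePreserving_eval (fun _ : Fin N => gaussianReal 0 1) i).map_eq
    have h2 := integral_map (μ := stdGaussianPi N) (φ := Function.eval i) (f := fun x : ℝ => x)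
      (measurable_pi_apply i).aemeasurable (by fun_prop)
    rw [h, integral_id_gaussianReal] at h2
    exact h2.symm
  have hvar : Var[∑ i, fun ω : Fin N → ℝ => ω i; stdGaussianPi N] = N := by
    rw [variance_sum_pi (X := fun _ x => x) fun _ => memLp_id_gaussianReal 2]
    simp [variance_fun_id_gaussianReal]
  have hcheb := meas_ge_le_variance_div_sq (μ := stdGaussianPi N)
    (X := ∑ i, fun ω : Fin N → ℝ => ω i) (memLp_finsetSum' _ fun i _ => hmem i) hc
  have hint : ∫ ω, (∑ i, fun ω : Fin N → ℝ => ω i) ω ∂(stdGaussianPi N) = 0 := by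
    simp only [Finset.sum_apply]
    rw [integral_finsetSum _ fun i _ => (hmem i).integrable one_le_two]
    simp [hmean]
  rw [hvar, hint] at hcheb
  simpa only [Finset.sum_apply, sub_zero] using hcheb

/-! ### Asymptotics at the scale `√(2 log N)` -/

lemma tendsto_sqrt_two_log : Tendsto (fun N : ℕ => Real.sqrt (2 * Real.log N)) atTop atTop :=
  Real.tendsto_sqrt_atTop.comp
    ((Real.tendsto_log_atTop.comp tendsto_natCast_atTop_atTop).const_mul_atTop two_pos)

lemma natCast_eq_exp_sq_half {N : ℕ} (hN : 0 < N) :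
    (N : ℝ) = Real.exp (Real.sqrt (2 * Real.log N) ^ 2 / 2) := by
  have h1 : (1 : ℝ) ≤ N := Nat.one_le_cast.2 hN
  rw [Real.sq_sqrt (mul_nonneg two_pos.le (Real.log_nonneg h1)),
    mul_div_cancel_left₀ _ two_ne_zero, Real.exp_log (by linarith)]

lemma tendsto_natCast_mul_gaussianPDFReal {c : ℝ} (hc0 : 0 ≤ c) (hc1 : c < 1) :
    Tendsto (fun N : ℕ => N * gaussianPDFReal 0 1 (c * Real.sqrt (2 * Real.log N) + 1))
      atTop atTop := by
  have hpoly : Tendsto (fun x : ℝ => x * ((1 - c ^ 2) * x - 2 * c) / 2 - 1 / 2) atTop atTop := by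
    have h1 : Tendsto (fun x : ℝ => (1 - c ^ 2) * x - 2 * c) atTop atTop :=
      tendsto_atTop_add_const_right _ _ (tendsto_id.const_mul_atTop (by nlinarith))
    exact tendsto_atTop_add_const_right _ _
      ((tendsto_id.atTop_mul_atTop₀ h1).atTop_div_const two_pos)
  have h := ((Real.tendsto_exp_atTop.comp (hpoly.comp tendsto_sqrt_two_log)).const_mul_atTop
    (inv_pos.2 (Real.sqrt_pos.2 Real.two_pi_pos)))
  refine h.congr' ?_
  filter_upwards [eventually_gt_atTop 0] with N hN
  simp only [Function.comp_apply]
  conv_rhs => rw [natCast_eq_exp_sq_half hN, gaussianPDFReal_zero_one, mul_left_comm,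
    ← Real.exp_add, ← natCast_eq_exp_sq_half hN]
  congr 2
  ring

/-- Below the critical scale, synchrony forces all frequencies on one side of `± c √(2 log N)` for
some `c < 1`. -/
lemma eventually_fullSynchrony_subset {δ c : ℝ} (hδ : δ ≤ c) (hc : 0 < c) :
    ∀ᶠ N : ℕ in atTop, {ω : Fin N → ℝ | FullSynchrony ω (δ * scaling N)} ⊆
      {ω | ∀ i, ω i ≤ c * Real.sqrt (2 * Real.log N)} ∪
        {ω | ∀ i, -(c * Real.sqrt (2 * Real.log N)) ≤ ω i} := by
  have hsqrt : Tendsto (fun N : ℕ => Real.sqrt N) atTop atTop :=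
    Real.tendsto_sqrt_atTop.comp tendsto_natCast_atTop_atTop
  filter_upwards [hsqrt.eventually_ge_atTop (-δ / c)] with N hNδ ω hω
  obtain ⟨Ω, hΩ⟩ := FullSynchrony.exists_abs_sub_le hω
  have hL := Real.sqrt_nonneg (2 * Real.log N)
  have hN0 : (0 : ℝ) ≤ N := Nat.cast_nonneg N
  have hbound : (if 0 ≤ δ * scaling N then δ * scaling N * N else
      -(δ * scaling N) * Real.sqrt N) ≤ c * Real.sqrt (2 * Real.log N) := by
    rw [scaling]
    split_ifs
    · rw [mul_div_assoc', div_mul_eq_mul_div, div_le_iff₀ (by linarith)]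
      have := mul_le_mul_of_nonneg_right hδ hL
      nlinarith [mul_nonneg hc.le hL]
    · rw [mul_div_assoc', ← neg_div, div_mul_eq_mul_div, div_le_iff₀ (by linarith)]
      have h1 : -δ * Real.sqrt N ≤ c * (N + 1) := by
        rw [div_le_iff₀ hc] at hNδ
        nlinarith [Real.mul_self_sqrt hN0, Real.sqrt_nonneg (N : ℝ)]
      nlinarith
  have hab (i : Fin N) := abs_le.1 ((hΩ i).trans hbound)
  rcases le_total Ω 0 with h | h
  · exact Or.inl fun i => by linarith [(hab i).2]
  · exact Or.inr fun i => by linarith [(hab i).1]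

lemma tendsto_probSync_zero {δ : ℝ} (hδ : δ < 1) :
    Tendsto (fun N : ℕ => probSync (δ * scaling N) N) atTop (𝓝 0) := by
  set c : ℝ := max δ (1 / 2)
  have hc0 : 0 < c := lt_of_lt_of_le (by norm_num) (le_max_right _ _)
  have hc1 : c < 1 := max_lt hδ (by norm_num)
  have hlim : Tendsto (fun N : ℕ => 2 * ENNReal.ofReal (Real.exp (-(N *
      gaussianPDFReal 0 1 (c * Real.sqrt (2 * Real.log N) + 1))))) atTop (𝓝 0) := by
    have h := ENNReal.tendsto_ofReal (Real.tendsto_exp_neg_atTop_nhds_zero.comp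
      (tendsto_natCast_mul_gaussianPDFReal hc0.le hc1))
    rw [ENNReal.ofReal_zero] at h
    simpa using ENNReal.Tendsto.const_mul h (Or.inr ENNReal.ofNat_ne_top)
  refine tendsto_of_tendsto_of_tendsto_of_le_of_le' tendsto_const_nhds hlim
    (Eventually.of_forall fun _ => zero_le) ?_
  filter_upwards [eventually_fullSynchrony_subset (le_max_left δ (1 / 2)) hc0] with N hN
  have ha : 0 ≤ c * Real.sqrt (2 * Real.log N) := by positivity
  calc probSync (δ * scaling N) N ≤ _ := measure_mono hN
    _ ≤ _ := measure_union_le _ _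
    _ ≤ _ := by
      rw [two_mul (ENNReal.ofReal _)]
      exact add_le_add (stdGaussianPi_forall_le ha N) (stdGaussianPi_forall_neg_le ha N)

lemma eventually_four_mul_log_le : ∀ᶠ N : ℕ in atTop, 4 * Real.log N ≤ N := by
  have h := (Real.isLittleO_log_id_atTop.comp_tendsto tendsto_natCast_atTop_atTop).bound
    (show (0 : ℝ) < 1 / 4 by norm_num)
  filter_upwards [h] with N hN
  have hN' : |Real.log N| ≤ 1 / 4 * N := by simpa using hN
  linarith [le_abs_self (Real.log N)]

/-- With `L = √(2 log N)`, synchrony at `δ ≥ 2` can fail only if some `|ωᵢ| ≥ L - 1 / L` or the mean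
has modulus at least `1 / (2 L)`: otherwise all `ωᵢ` are within `L - 1 / (2 L) ≤ L N / (N + 1)` of
their mean. -/
lemma eventually_subset_fullSynchrony {δ : ℝ} (hδ : 2 ≤ δ) :
    ∀ᶠ N : ℕ in atTop, Set.univ ⊆ {ω : Fin N → ℝ | FullSynchrony ω (δ * scaling N)} ∪
      ({ω | ∃ i, Real.sqrt (2 * Real.log N) - 1 / Real.sqrt (2 * Real.log N) ≤ |ω i|} ∪
        {ω | N / (2 * Real.sqrt (2 * Real.log N)) ≤ |∑ i, ω i|}) := by
  filter_upwards [eventually_gt_atTop 0, eventually_four_mul_log_le,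
    tendsto_sqrt_two_log.eventually_gt_atTop 0] with N hN hlog hL ω _
  have hLsq : Real.sqrt (2 * Real.log N) ^ 2 = 2 * Real.log N :=
    Real.sq_sqrt (Real.sqrt_pos.1 hL).le
  set L := Real.sqrt (2 * Real.log N) with hLdef
  have hN' : (0 : ℝ) < N := Nat.cast_pos.2 hN
  by_contra! hcon
  simp only [Set.mem_union, Set.mem_ofPred_eq, not_or, not_exists, not_le] at hcon
  obtain ⟨hns, hi, hmean⟩ := hcon
  refine hns (fullSynchrony_of_abs_sub_lt (Ω := (∑ i, ω i) / N) hN ?_ (by field_simp) fun i => ?_)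
  · rw [scaling]
    positivity
  · have h1 : |(∑ i, ω i) / N| < 1 / (2 * L) := by
      rw [abs_div, abs_of_pos hN', div_lt_iff₀ hN']
      calc _ < _ := hmean
        _ = _ := by ring
    have h2 : L - 1 / (2 * L) ≤ δ * scaling N * N / 2 := by
      rw [scaling, ← hLdef]
      have h3 : L - 1 / (2 * L) ≤ L * N / (N + 1) := by
        have : L * N / (N + 1) = L - L / (N + 1) := by field_simp; ring
        rw [this]
        refine sub_le_sub_left ?_ L
        rw [div_le_div_iff₀ (by linarith) (by linarith)]
        nlinarith
      calc _ ≤ _ := h3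
        _ ≤ δ / 2 * (L * N / (N + 1)) := le_mul_of_one_le_left (by positivity) (by linarith)
        _ = _ := by ring
    calc _ ≤ |ω i| + |(∑ i, ω i) / N| := abs_sub _ _
      _ < (L - 1 / L) + 1 / (2 * L) := add_lt_add (hi i) h1
      _ = L - 1 / (2 * L) := by field_simp; ring
      _ ≤ _ := h2

lemma tendsto_maximum_bound : Tendsto (fun N : ℕ => ENNReal.ofReal
    (N * (2 * (Real.exp (-(Real.sqrt (2 * Real.log N) - 1 / Real.sqrt (2 * Real.log N)) ^ 2 / 2) /
      (Real.sqrt (2 * Real.log N) - 1 / Real.sqrt (2 * Real.log N)))))) atTop (𝓝 0) := by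
  rw [← ENNReal.ofReal_zero]
  refine ENNReal.tendsto_ofReal ?_
  have hlim : Tendsto (fun N : ℕ => 4 * Real.exp 1 / Real.sqrt (2 * Real.log N)) atTop (𝓝 0) :=
    tendsto_const_nhds.div_atTop tendsto_sqrt_two_log
  refine tendsto_of_tendsto_of_tendsto_of_le_of_le' tendsto_const_nhds hlim ?_ ?_
  all_goals
    filter_upwards [eventually_gt_atTop 0, tendsto_sqrt_two_log.eventually_ge_atTop 2] with N hN hL
    have hexp := natCast_eq_exp_sq_half hN
    set L := Real.sqrt (2 * Real.log N)
    have hinv : 1 / L ≤ L / 2 := by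
      rw [div_le_div_iff₀ (by linarith) two_pos]
      nlinarith
    have ht : 0 < L - 1 / L := by linarith
  · positivity
  · -- `(L - 1 / L) ^ 2 ≥ L ^ 2 - 2` and `exp (L ^ 2 / 2) = N`
    have he : N * Real.exp (-(L - 1 / L) ^ 2 / 2) ≤ Real.exp 1 := by
      rw [hexp, ← Real.exp_add, Real.exp_le_exp]
      have : (L - 1 / L) ^ 2 = L ^ 2 - 2 + (1 / L) ^ 2 := by field_simp; ring
      rw [this]
      nlinarith [sq_nonneg (1 / L)]
    calc N * (2 * (Real.exp (-(L - 1 / L) ^ 2 / 2) / (L - 1 / L)))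
        = 2 * (N * Real.exp (-(L - 1 / L) ^ 2 / 2)) / (L - 1 / L) := by ring
      _ ≤ 2 * Real.exp 1 / (L / 2) := by
          gcongr
          linarith
      _ = _ := by ring

lemma tendsto_mean_bound : Tendsto (fun N : ℕ => ENNReal.ofReal
    (N / (N / (2 * Real.sqrt (2 * Real.log N))) ^ 2)) atTop (𝓝 0) := by
  rw [← ENNReal.ofReal_zero]
  refine ENNReal.tendsto_ofReal ?_
  have h := ((Real.isLittleO_log_id_atTop.comp_tendsto
    tendsto_natCast_atTop_atTop).tendsto_div_nhds_zero).const_mul 8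
  rw [mul_zero] at h
  refine h.congr' ?_
  filter_upwards [eventually_gt_atTop 0, tendsto_sqrt_two_log.eventually_gt_atTop 0] with N hN hL
  have hLsq : Real.sqrt (2 * Real.log N) ^ 2 = 2 * Real.log N :=
    Real.sq_sqrt (Real.sqrt_pos.1 hL).le
  have hN' : (0 : ℝ) < N := Nat.cast_pos.2 hN
  simp only [Function.comp_apply, id]
  rw [div_pow, mul_pow, hLsq]
  have : Real.log N ≠ 0 := by
    have := Real.sqrt_pos.1 hL
    intro h0
    simp [h0] at this
  field_simp
  norm_num

lemma tendsto_probSync_one {δ : ℝ} (hδ : 2 ≤ δ) :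
    Tendsto (fun N : ℕ => probSync (δ * scaling N) N) atTop (𝓝 1) := by
  have hlim := ENNReal.Tendsto.sub (tendsto_const_nhds (x := (1 : ℝ≥0∞)))
    (tendsto_maximum_bound.add tendsto_mean_bound) (Or.inl ENNReal.one_ne_top)
  rw [add_zero, tsub_zero] at hlim
  refine tendsto_of_tendsto_of_tendsto_of_le_of_le' hlim tendsto_const_nhds ?_
    (Eventually.of_forall fun _ => prob_le_one)
  filter_upwards [eventually_subset_fullSynchrony hδ, eventually_gt_atTop 0,
    tendsto_sqrt_two_log.eventually_ge_atTop 2] with N hN hN0 hL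
  have hinv : 1 / Real.sqrt (2 * Real.log N) ≤ 1 := (div_le_one (by linarith)).2 (by linarith)
  -- subadditivity avoids any measurability of the synchrony event
  rw [tsub_le_iff_right, ← measure_univ (μ := stdGaussianPi N)]
  refine (measure_mono hN).trans ((measure_union_le _ _).trans (add_le_add_right
    ((measure_union_le _ _).trans (add_le_add ?_ ?_)) _))
  · exact stdGaussianPi_exists_le_abs (by linarith) N
  · exact stdGaussianPi_le_abs_sum (div_pos (Nat.cast_pos.2 hN0) (by linarith)) N

end Kuramoto

theorem theorem3p1 (δ : ℝ) :
    (δ < 1 →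
      Tendsto (fun N : ℕ => Kuramoto.probSync (δ * Kuramoto.scaling N) N) atTop (𝓝 0)) ∧
    (2 ≤ δ →
      Tendsto (fun N : ℕ => Kuramoto.probSync (δ * Kuramoto.scaling N) N) atTop (𝓝 1)) :=
  ⟨Kuramoto.tendsto_probSync_zero, Kuramoto.tendsto_probSync_one⟩
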